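/- Let $J=[-1,1]$, $\mathring J=(-1,1)$, and $J_s=J\times\{s\}$ for $s\in J$. Let $f_{01}:J\to J$ be the homeomorphism with $f_{01}(s)=(s+1)/2$ for $0\le s\le 1$, $f_{01}(s)=s+1/2$ for $-1/2\le s\le 0$, and $f_{01}(s)=2s+1$ for $-1\le s\le -1/2$, and let $f_{02}(r,s)=(r,f_{01}(s))$ on $J^2$. A homeomorphism $f:J^2\to J^2$ is called normally rising if $f=f_{02}$ on the boundary $\partial J^2$ of the square and $f(J_s)=f_{02}(J_s)$ for every $s\in J$. For a homeomorphism $f$ of $J^2$ and $x\in J^2$, let $\omega_f(x)$ be the set of all limits of convergent sequences $f^{n_i}(x)$ with positive integers $n_1<n_2<\cdots$, and let $\alpha_f(x)=\omega_{f^{-1}}(x)$. Let $\mathcal A$ and $\mathcal A'$ be the collections of all nonempty connected closed subsets of $J_1$ and of $J_{-1}$, respectively (closed subintervals of the top and of the bottom edge, single points allowed). **Corollary 3.3.** Let $\mathbb N^*$ be a nonempty set of positive integers. For any maps $\omega:\mathbb N^*\to\mathcal A$ and $\alpha:\mathbb N^*\to\mathcal A'$ there exist a family $\{S_n:n\in\mathbb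 N^*\}$ of pairwise disjoint countable subsets of $\mathring J$ and a normally rising homeomorphism $f:J^2\to J^2$ such that, for every $n\in\mathbb N^*$, the set $S_n$ is dense in $J$, and $\omega_f(r,s)=\omega(n)$ and $\alpha_f(r,s)=\alpha(n)$ for all $(r,s)\in\mathring J\times S_n$. -/

import Mathlib

open Set Filter Topology

namespace NormallyRising

/-- The interval `J = [-1, 1]`. -/
abbrev J : Type := ↥(Set.Icc (-1 : ℝ) 1)

/-- The endpoint `-1` of `J`. -/
def jBot : J := ⟨-1, by norm_num⟩

/-- The endpoint `1` of `J`. -/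
def jTop : J := ⟨1, by norm_num⟩

/-- The open interval `(-1, 1)`, as a subset of `J`. -/
def jInterior : Set J := {s | -1 < (s : ℝ) ∧ (s : ℝ) < 1}

/-- The formula of the piecewise linear model map of `J`. -/
noncomputable def f01Fun (s : ℝ) : ℝ :=
  if 0 ≤ s then (s + 1) / 2 else if -1 / 2 ≤ s then s + 1 / 2 else 2 * s + 1

theorem f01Fun_mem {s : ℝ} (hs : s ∈ Set.Icc (-1 : ℝ) 1) :
    f01Fun s ∈ Set.Icc (-1 : ℝ) 1 := by
  obtain ⟨h1, h2⟩ := hs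
  unfold f01Fun
  split_ifs <;> constructor <;> linarith

/-- The piecewise linear model map `J → J`. -/
noncomputable def f01 (s : J) : J := ⟨f01Fun s, f01Fun_mem s.2⟩

/-- The model map `(r, s) ↦ (r, f01 s)` of the square. -/
noncomputable def f02 (p : J × J) : J × J := (p.1, f01 p.2)

/-- The horizontal segment `J_s = J × {s}`. -/
def row (s : J) : Set (J × J) := {p | p.2 = s}

/-- The boundary of the square: the points with some coordinate equal to `-1` or `1`. -/
def squareBoundary : Set (J × J) := {p | p.1 = jBot ∨ p.1 = jTop ∨ p.2 = jBot ∨ p.2 = jTop}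

/-- A homeomorphism of the square is normally rising if it agrees with `f02` on the boundary
and sends every horizontal segment onto the same horizontal segment as `f02` does. -/
def IsNormallyRising (f : (J × J) ≃ₜ (J × J)) : Prop :=
  Set.EqOn f f02 squareBoundary ∧ ∀ s : J, f '' row s = f02 '' row s

/-- The collection of nonempty connected closed subsets of `J_s` (the closed subintervals of
`J_s`, single points included); `IsConnected` contains non-emptiness. -/
def rowContinua (s : J) : Set (Set (J × J)) :=
  {A | IsConnected A ∧ IsClosed A ∧ A ⊆ row s}

/-- The `ω`-limit set of `x`: the limits of `f^{n_i}(x)` for positive integers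
`n_1 < n_2 < ⋯`. -/
def omegaLimitSet {X : Type*} [TopologicalSpace X] (f : X ≃ₜ X) (x : X) : Set X :=
  {y | ∃ n : ℕ → ℕ, (∀ i, 0 < n i) ∧ StrictMono n ∧
    Tendsto (fun i => f^[n i] x) atTop (𝓝 y)}

/-- The `α`-limit set of `x`: its `ω`-limit set under the inverse homeomorphism. -/
def alphaLimitSet {X : Type*} [TopologicalSpace X] (f : X ≃ₜ X) (x : X) : Set X :=
  omegaLimitSet f.symm x

end NormallyRising

namespace NormallyRising

/-! The homeomorphism is a skew product `(r, s) ↦ (F s r, f01 s)` whose fibre maps `F s` are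
increasing homeomorphisms of `J`. The coordinate `psi` turns `f01` on the interior into translation
by `1` on `ℝ`, so an orbit of heights becomes a coset `x + ℤ`. Label `n` gets the heights `n√2 + ℚ`:
countable, dense, pairwise disjoint and invariant under integer translation.

Along an orbit with label `n`, the fibre maps are chosen so that their compositions are eventually
the maps `push`, which drive every interior `r` towards a moving target. The target sweeps the
interval `ω n` (or `α n` in the past) with steps of size `1/(j+1)`, so every point of the interval
is a limit, yet the fibre maps tend to the identity (`abs_push_sub_le`, `tendsto_push_sub`,
`exists_tendsto_sweep`).

To make `F` continuous, each orbit is prescribed only where `|⌊x⌋|` is at least its index in an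
injective enumeration. The prescribed heights are then locally finite (`eventually_eq_of_active`),
and convexity of the set of increasing homeomorphisms gives a continuous extension within
`11/(1+|x|)` of the identity. The finitely many unprescribed steps of an orbit keep interior points
interior, so they do not affect its limit sets (`limitSets_eq`). -/

/-! ### Increasing homeomorphisms of `J` as a convex set of functions -/

/-- The strictly increasing continuous functions on `J` with value `-1` at `-1` and `1` at `1`. -/
def increasingHomeos : Set C(J, ℝ) := {h | StrictMono h ∧ h jBot = -1 ∧ h jTop = 1}

theorem jBot_le (r : J) : jBot ≤ r := Subtype.coe_le_coe.1 r.2.1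

theorem le_jTop (r : J) : r ≤ jTop := Subtype.coe_le_coe.1 r.2.2

theorem mem_of_mem_increasingHomeos {h : C(J, ℝ)} (hh : h ∈ increasingHomeos) (r : J) :
    h r ∈ Icc (-1 : ℝ) 1 :=
  ⟨hh.2.1.symm.trans_le (hh.1.monotone (jBot_le r)),
    (hh.1.monotone (le_jTop r)).trans_eq hh.2.2⟩

theorem convex_increasingHomeos : Convex ℝ increasingHomeos := by
  rintro f ⟨hf, hf1, hf2⟩ g ⟨hg, hg1, hg2⟩ a b ha hb hab
  refine ⟨fun x y hxy => ?_, ?_, ?_⟩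
  · have h1 := hf hxy
    have h2 := hg hxy
    simp only [ContinuousMap.add_apply, ContinuousMap.smul_apply, smul_eq_mul]
    rcases ha.eq_or_lt with rfl | ha
    · have : b = 1 := by linarith
      subst this; linarith
    · exact add_lt_add_of_lt_of_le (mul_lt_mul_of_pos_left h1 ha)
        (mul_le_mul_of_nonneg_left h2.le hb)
  · simp [hf1, hg1]; linarith
  · simp [hf2, hg2, hab]

instance : PreconnectedSpace J := Subtype.preconnectedSpace isPreconnected_Icc

/-- An element of `increasingHomeos` as an order isomorphism of `J`. -/
noncomputable def toIso (h : C(J, ℝ)) (hh : h ∈ increasingHomeos) : J ≃o J :=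
  StrictMono.orderIsoOfSurjective (fun r => (⟨h r, mem_of_mem_increasingHomeos hh r⟩ : J))
    (fun _ _ hxy => Subtype.coe_lt_coe.1 (hh.1 hxy)) (by
      intro y
      have hc : Continuous fun r => (⟨h r, mem_of_mem_increasingHomeos hh r⟩ : J) :=
        h.continuous.subtype_mk _
      refine mem_range_of_exists_le_of_exists_ge hc ⟨jBot, ?_⟩ ⟨jTop, ?_⟩
      · exact Subtype.coe_le_coe.1 (by simpa [hh.2.1] using y.2.1)
      · exact Subtype.coe_le_coe.1 (by simpa [hh.2.2] using y.2.2))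

@[simp] theorem coe_toIso (h : C(J, ℝ)) (hh : h ∈ increasingHomeos) (r : J) :
    (toIso h hh r : ℝ) = h r := rfl

/-- The inclusion `J → ℝ`. -/
def valMap : C(J, ℝ) := ⟨Subtype.val, continuous_subtype_val⟩

@[simp] theorem valMap_apply (r : J) : valMap r = r := rfl

theorem coe_iso_mem (e : J ≃o J) :
    (⟨fun r => (e r : ℝ), continuous_subtype_val.comp e.continuous⟩ : C(J, ℝ))
      ∈ increasingHomeos := by
  refine ⟨fun x y hxy => Subtype.coe_lt_coe.2 (e.strictMono hxy), ?_, ?_⟩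
  · have : e jBot = jBot :=
      le_antisymm (by simpa using e.monotone (jBot_le (e.symm jBot))) (jBot_le _)
    exact congrArg Subtype.val this
  · have : e jTop = jTop :=
      le_antisymm (le_jTop _) (by simpa using e.monotone (le_jTop (e.symm jTop)))
    exact congrArg Subtype.val this

theorem valMap_mem : valMap ∈ increasingHomeos := coe_iso_mem (OrderIso.refl J)

theorem toIso_mem_jInterior (h : C(J, ℝ)) (hh : h ∈ increasingHomeos) (r : J) :
    toIso h hh r ∈ jInterior ↔ r ∈ jInterior := by
  have h1 : (-1 : ℝ) < r ↔ jBot < r := Iff.rfl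
  have h2 : (r : ℝ) < 1 ↔ r < jTop := Iff.rfl
  simp only [jInterior, mem_ofPred_eq, coe_toIso]
  rw [h1, h2, ← hh.1.lt_iff_lt (b := r), ← hh.1.lt_iff_lt (a := r), hh.2.1, hh.2.2]

/-! ### The model map -/

/-- The slopes 2, 1, 1/2 decrease, so the function is concave and is the minimum of its affine
pieces; continuity and monotonicity follow without cases. -/
theorem f01Fun_eq_min (s : ℝ) : f01Fun s = min (min ((s + 1) / 2) (s + 1 / 2)) (2 * s + 1) := by
  unfold f01Fun
  split_ifs with h1 h2
  · rw [min_eq_left (by linarith : (s + 1) / 2 ≤ s + 1 / 2), min_eq_left (by linarith)]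
  · rw [min_eq_right (by linarith : s + 1 / 2 ≤ (s + 1) / 2), min_eq_left (by linarith)]
  · rw [min_eq_right]
    exact le_min (by linarith) (by linarith)

theorem continuous_f01Fun : Continuous f01Fun := by
  have : f01Fun = fun s => min (min ((s + 1) / 2) (s + 1 / 2)) (2 * s + 1) :=
    funext f01Fun_eq_min
  rw [this]
  fun_prop

theorem strictMono_f01Fun : StrictMono f01Fun := by
  intro x y hxy
  rw [f01Fun_eq_min, f01Fun_eq_min]
  exact min_lt_min (min_lt_min (by linarith) (by linarith)) (by linarith)

theorem f01Fun_mem_increasingHomeos :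
    (⟨fun s => f01Fun s, continuous_f01Fun.comp continuous_subtype_val⟩ : C(J, ℝ))
      ∈ increasingHomeos := by
  refine ⟨fun x y hxy => strictMono_f01Fun hxy, ?_, ?_⟩ <;> norm_num [f01Fun, jBot, jTop]

/-- The model map of `J` as an order isomorphism. -/
noncomputable def f01Iso : J ≃o J := toIso _ f01Fun_mem_increasingHomeos

@[simp] theorem f01Iso_apply (s : J) : f01Iso s = f01 s := rfl

/-- The midpoint of `J`. -/
def jZero : J := ⟨0, by norm_num⟩

theorem coe_f01Iso_pow_jZero (n : ℕ) : (((f01Iso ^ n) jZero : J) : ℝ) = 1 - (1 / 2) ^ n := by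
  induction n with
  | zero => simp [jZero]
  | succ n ih =>
    rw [pow_succ', RelIso.mul_apply]
    change f01Fun ((f01Iso ^ n) jZero : J) = _
    have h : (1 / 2 : ℝ) ^ n ≤ 1 := pow_le_one₀ (by norm_num) (by norm_num)
    rw [ih, f01Fun, if_pos (by linarith)]
    ring

theorem coe_f01Iso_zpow_neg_jZero (n : ℕ) :
    (((f01Iso ^ (-(n : ℤ))) jZero : J) : ℝ) = -1 + (1 / 2) ^ n := by
  have hn (n : ℕ) : (-1 + (1 / 2 : ℝ) ^ n) ∈ Icc (-1 : ℝ) 1 := by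
    have h : (1 / 2 : ℝ) ^ n ≤ 1 := pow_le_one₀ (by norm_num) (by norm_num)
    have h' : (0 : ℝ) < (1 / 2) ^ n := by positivity
    constructor <;> linarith
  -- Running forward from the claimed point to the midpoint avoids a formula for the inverse map.
  have key : (f01Iso ^ n) ⟨_, hn n⟩ = jZero := by
    induction n with
    | zero => simp [jZero]
    | succ n ih =>
      rw [pow_succ, RelIso.mul_apply, ← ih]
      congr 1
      apply Subtype.ext
      change f01Fun (-1 + (1 / 2) ^ (n + 1)) = -1 + (1 / 2) ^ n
      have h : (1 / 2 : ℝ) ^ n ≤ 1 := pow_le_one₀ (by norm_num) (by norm_num)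
      rw [pow_succ, f01Fun]
      split_ifs with h1 h2 <;> linarith
  rw [← key, ← zpow_natCast, ← RelIso.mul_apply, ← zpow_add]
  simp

theorem half_fract_mem (x : ℝ) : Int.fract x / 2 ∈ Icc (-1 : ℝ) 1 := by
  have h1 := Int.fract_nonneg x
  have h2 := Int.fract_lt_one x
  constructor <;> linarith

/-- A coordinate on the interior of `J` in which the model map is the translation by `1`. -/
noncomputable def psi (x : ℝ) : J := (f01Iso ^ ⌊x⌋) ⟨Int.fract x / 2, half_fract_mem x⟩

theorem psi_add_one (x : ℝ) : psi (x + 1) = f01 (psi x) := by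
  unfold psi
  rw [Int.floor_add_one, add_comm, zpow_add, zpow_one, RelIso.mul_apply]
  simp [Int.fract_add_one]

theorem psi_intCast (m : ℤ) : psi m = (f01Iso ^ m) jZero := by
  simp [psi, jZero]

/-- Hence `[0, 1/2)` is a fundamental domain on the interior, which is why `psi` halves the
fractional part. -/
theorem f01_jZero : f01 jZero = ⟨1 / 2, by norm_num⟩ := by
  apply Subtype.ext
  simp [f01, jZero, f01Fun]

theorem psi_lt_floor_add_one (x : ℝ) : psi x < psi ((⌊x⌋ + 1 : ℤ) : ℝ) := by
  rw [psi_intCast, zpow_add, zpow_one, RelIso.mul_apply, f01Iso_apply, f01_jZero, psi]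
  apply (f01Iso ^ ⌊x⌋).strictMono
  have h2 := Int.fract_lt_one x
  exact Subtype.coe_lt_coe.1 (by simpa using by linarith)

theorem psi_floor_le (x : ℝ) : psi (⌊x⌋ : ℝ) ≤ psi x := by
  rw [psi_intCast, psi]
  apply (f01Iso ^ ⌊x⌋).monotone
  exact Subtype.coe_le_coe.1 (by simp only [jZero]; linarith [Int.fract_nonneg x])

theorem strictMono_psi_intCast : StrictMono fun m : ℤ => psi (m : ℝ) := by
  refine strictMono_int_of_lt_succ fun m => ?_
  simpa using psi_lt_floor_add_one (m : ℝ)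

theorem strictMono_psi : StrictMono psi := by
  intro x y hxy
  rcases (Int.floor_mono hxy.le).eq_or_lt with h | h
  · unfold psi
    rw [h]
    apply (f01Iso ^ ⌊y⌋).strictMono
    apply Subtype.coe_lt_coe.1
    have := Int.floor_add_fract x
    have := Int.floor_add_fract y
    rw [h] at *
    simp only
    linarith
  · exact (psi_lt_floor_add_one x).trans_le
      ((strictMono_psi_intCast.monotone (Int.add_one_le_iff.2 h)).trans (psi_floor_le y))

theorem range_psi : range psi = jInterior := by
  ext s
  constructor
  · rintro ⟨x, rfl⟩
    constructor
    · exact (Subtype.coe_le_coe.2 (jBot_le (psi (x - 1)))).trans_lt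
        (Subtype.coe_lt_coe.2 (strictMono_psi (by linarith)))
    · exact (Subtype.coe_lt_coe.2 (strictMono_psi (by linarith))).trans_le
        (Subtype.coe_le_coe.2 (le_jTop (psi (x + 1))))
  · rintro ⟨h1, h2⟩
    obtain ⟨n, hn⟩ := exists_pow_lt_of_lt_one (sub_pos.2 h2) (by norm_num : (1 / 2 : ℝ) < 1)
    obtain ⟨k, hk⟩ := exists_pow_lt_of_lt_one (by linarith : 0 < (s : ℝ) + 1)
      (by norm_num : (1 / 2 : ℝ) < 1)
    have hn' : s < psi ((n : ℤ) : ℝ) := by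
      rw [psi_intCast, zpow_natCast, ← Subtype.coe_lt_coe, coe_f01Iso_pow_jZero]
      linarith
    have hk' : psi ((-(k : ℤ) : ℤ) : ℝ) ≤ s := by
      rw [psi_intCast, ← Subtype.coe_le_coe, coe_f01Iso_zpow_neg_jZero]
      linarith
    -- The largest such `m` is the power that carries the fundamental domain onto the piece
    -- containing `s`.
    obtain ⟨m, hm, hmax⟩ := Int.exists_greatest_of_bdd (P := fun m : ℤ => psi (m : ℝ) ≤ s)
      ⟨n, fun z hz => (strictMono_psi_intCast.lt_iff_lt.1 (hz.trans_lt hn')).le⟩ ⟨_, hk'⟩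
    have hlt : s < psi ((m + 1 : ℤ) : ℝ) := by
      by_contra! h
      exact absurd (hmax _ h) (by simp)
    have h3 : jZero ≤ (f01Iso ^ m).symm s := by
      rw [OrderIso.le_symm_apply]
      rwa [← psi_intCast]
    have h4 : (f01Iso ^ m).symm s < ⟨1 / 2, by norm_num⟩ := by
      rw [OrderIso.symm_apply_lt, ← f01_jZero]
      rwa [psi_intCast, zpow_add, zpow_one, RelIso.mul_apply] at hlt
    set u := (f01Iso ^ m).symm s with hu
    have h3' : (0 : ℝ) ≤ u := h3
    have h4' : (u : ℝ) < 1 / 2 := h4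
    have hfl : ⌊(m : ℝ) + 2 * u⌋ = m := by
      rw [Int.floor_eq_iff]; constructor <;> linarith
    refine ⟨m + 2 * u, ?_⟩
    have : (⟨Int.fract ((m : ℝ) + 2 * u) / 2, half_fract_mem _⟩ : J) = u := by
      apply Subtype.ext
      simp only [Int.fract, hfl]
      ring
    rw [psi, this, hfl, hu, OrderIso.apply_symm_apply]

theorem jInterior_eq_Ioo : jInterior = Ioo jBot jTop := rfl

/-- Continuity at the integers needs no check: a strictly monotone map with order-connected range is
an embedding. -/
theorem isOpenEmbedding_psi : IsOpenEmbedding psi := by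
  refine ⟨strictMono_psi.isEmbedding_of_ordConnected ?_, ?_⟩
  · rw [range_psi, jInterior_eq_Ioo]; exact ordConnected_Ioo
  · rw [range_psi, jInterior_eq_Ioo]; exact isOpen_Ioo

theorem denseRange_psi : DenseRange psi := by
  rw [DenseRange, range_psi, jInterior_eq_Ioo, dense_iff_closure_eq, closure_Ioo]
  · exact eq_univ_of_forall fun r => ⟨jBot_le r, le_jTop r⟩
  · intro h
    have := congrArg Subtype.val h
    norm_num [jBot, jTop] at this

theorem tendsto_psi_atTop : Tendsto psi atTop (𝓝 jTop) := by
  have h := tendsto_atTop_isLUB strictMono_psi.monotone (a := jTop) ?_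
  · exact h
  · refine ⟨fun y _ => le_jTop y, fun y hy => ?_⟩
    have hc : IsClosed (Iic y) := isClosed_Iic
    exact closure_minimal (s := range psi) hy hc (denseRange_psi jTop)

theorem tendsto_psi_atBot : Tendsto psi atBot (𝓝 jBot) := by
  refine tendsto_atBot_isGLB strictMono_psi.monotone (a := jBot) ?_
  refine ⟨fun y _ => jBot_le y, fun y hy => ?_⟩
  exact closure_minimal (s := range psi) hy (isClosed_Ici (a := y)) (denseRange_psi jBot)

/-! ### Normally rising homeomorphisms from families of homeomorphisms of `J` -/

/-- The map `(r, s) ↦ (F s r, f01 s)`. -/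
noncomputable def skewMap (F : J → C(J, ℝ)) (hF : ∀ s, F s ∈ increasingHomeos) (p : J × J) :
    J × J :=
  (toIso (F p.2) (hF p.2) p.1, f01 p.2)

theorem skewMap_bijective (F : J → C(J, ℝ)) (hF : ∀ s, F s ∈ increasingHomeos) :
    Function.Bijective (skewMap F hF) := by
  constructor
  · rintro ⟨r, s⟩ ⟨r', s'⟩ h
    obtain ⟨h1, h2⟩ := Prod.ext_iff.1 h
    have hs : s = s' := f01Iso.injective h2
    subst hs
    exact Prod.ext ((toIso (F s) (hF s)).injective h1) rfl
  · rintro ⟨r, s⟩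
    obtain ⟨s, rfl⟩ := f01Iso.surjective s
    obtain ⟨r, rfl⟩ := (toIso (F s) (hF s)).surjective r
    exact ⟨(r, s), rfl⟩

theorem continuous_skewMap {F : J → C(J, ℝ)} (hF : ∀ s, F s ∈ increasingHomeos)
    (hc : Continuous F) : Continuous (skewMap F hF) := by
  refine Continuous.prodMk (Continuous.subtype_mk ?_ _) (f01Iso.continuous.comp continuous_snd)
  exact ContinuousEval.continuous_eval.comp ((hc.comp continuous_snd).prodMk continuous_fst)

/-- The homeomorphism `(r, s) ↦ (F s r, f01 s)`. -/
noncomputable def skewHomeo (F : J → C(J, ℝ)) (hF : ∀ s, F s ∈ increasingHomeos)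
    (hc : Continuous F) : (J × J) ≃ₜ (J × J) :=
  Continuous.homeoOfEquivCompactToT2 (f := Equiv.ofBijective _ (skewMap_bijective F hF))
    (continuous_skewMap hF hc)

theorem skewHomeo_apply (F : J → C(J, ℝ)) (hF : ∀ s, F s ∈ increasingHomeos)
    (hc : Continuous F) (r s : J) :
    skewHomeo F hF hc (r, s) = (toIso (F s) (hF s) r, f01 s) := rfl

theorem isNormallyRising_skewHomeo (F : J → C(J, ℝ)) (hF : ∀ s, F s ∈ increasingHomeos)
    (hc : Continuous F) (hbot : F jBot = valMap) (htop : F jTop = valMap) :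
    IsNormallyRising (skewHomeo F hF hc) := by
  constructor
  · rintro ⟨r, s⟩ h
    rw [skewHomeo_apply, f02]
    refine Prod.ext (Subtype.ext ?_) rfl
    rw [coe_toIso]
    change r = jBot ∨ r = jTop ∨ s = jBot ∨ s = jTop at h
    rcases h with rfl | rfl | rfl | rfl
    · exact (hF s).2.1
    · exact (hF s).2.2
    · simp [hbot]
    · simp [htop]
  · intro s
    ext ⟨r, t⟩
    constructor
    · rintro ⟨⟨r', s'⟩, hs, h⟩
      obtain ⟨h1, h2⟩ := Prod.ext_iff.1 h
      exact ⟨(r, s'), hs, Prod.ext rfl h2⟩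
    · rintro ⟨⟨r', s'⟩, hs, h⟩
      obtain ⟨h1, h2⟩ := Prod.ext_iff.1 h
      exact ⟨((toIso (F s') (hF s')).symm r, s'), hs, Prod.ext (by simp [skewHomeo_apply]) h2⟩

/-- A family of homeomorphisms of `J` prescribed at a locally finite set of parameters extends to
a continuous family, within a given distance from the identity. -/
theorem exists_continuous_extension {X : Type*} [TopologicalSpace X] [NormalSpace X]
    [ParacompactSpace X] (A : Set X) (hA : ∀ x, ∀ᶠ y in 𝓝 x, y ∈ A → y = x)
    (η : X → ℝ) (hη : Continuous η) (hη0 : ∀ x, 0 < η x)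
    (h : X → C(J, ℝ)) (hh : ∀ x ∈ A, h x ∈ increasingHomeos ∧ dist (h x) valMap < η x) :
    ∃ g : C(X, C(J, ℝ)), ∀ x, g x ∈ increasingHomeos ∧ dist (g x) valMap < η x ∧
      (x ∈ A → g x = h x) := by
  refine exists_continuous_forall_mem_convex_of_local_const
    (t := fun x => {k | k ∈ increasingHomeos ∧ dist k valMap < η x ∧ (x ∈ A → k = h x)})
    (fun x => ?_) (fun x => ?_)
  · have hconv : Convex ℝ {k : C(J, ℝ) | x ∈ A → k = h x} := by
      by_cases hx : x ∈ A
      · have : {k : C(J, ℝ) | x ∈ A → k = h x} = {h x} := by ext; simp [hx]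
        rw [this]
        exact convex_singleton _
      · have : {k : C(J, ℝ) | x ∈ A → k = h x} = univ := by ext; simp [hx]
        rw [this]
        exact convex_univ
    exact convex_increasingHomeos.inter ((convex_ball valMap (η x)).inter hconv)
  -- Near a prescribed point no other point is prescribed, so its own map serves as a constant
  -- choice; elsewhere the identity does.
  · by_cases hx : x ∈ A
    · refine ⟨h x, ?_⟩
      filter_upwards [hA x, hη.continuousAt.eventually (lt_mem_nhds (hh x hx).2)] with y h1 h2
      exact ⟨(hh x hx).1, h2, fun hy => by rw [h1 hy]⟩
    · refine ⟨valMap, ?_⟩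
      filter_upwards [hA x] with y h1
      refine ⟨valMap_mem, by simpa using hη0 y, fun hy => absurd ?_ hx⟩
      rwa [← h1 hy]

/-- A continuous family of homeomorphisms of `J` parametrized by `ℝ` and asymptotic to the
identity, transported to the interior of `J`. -/
theorem exists_family (g : C(ℝ, C(J, ℝ))) (hg : ∀ x, g x ∈ increasingHomeos)
    (htop : Tendsto g atTop (𝓝 valMap)) (hbot : Tendsto g atBot (𝓝 valMap)) :
    ∃ F : J → C(J, ℝ), Continuous F ∧ (∀ s, F s ∈ increasingHomeos) ∧
      (∀ x, F (psi x) = g x) ∧ F jBot = valMap ∧ F jTop = valMap := by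
  have hval : ∀ x, Function.extend psi g (fun _ => valMap) (psi x) = g x :=
    fun x => strictMono_psi.injective.extend_apply _ _ _
  have hend : ∀ s, s ∉ jInterior → Function.extend psi g (fun _ => valMap) s = valMap := by
    intro s hs
    rw [← range_psi] at hs
    exact Function.extend_apply' _ _ _ hs
  have hB : Function.extend psi g (fun _ => valMap) jBot = valMap :=
    hend _ fun h => lt_irrefl _ h.1
  have hT : Function.extend psi g (fun _ => valMap) jTop = valMap :=
    hend _ fun h => lt_irrefl _ h.2
  have hcases : ∀ s : J, s = jBot ∨ s = jTop ∨ ∃ x, psi x = s := by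
    intro s
    rcases (jBot_le s).eq_or_lt with h | h
    · exact Or.inl h.symm
    rcases (le_jTop s).eq_or_lt with h' | h'
    · exact Or.inr (Or.inl h')
    · exact Or.inr (Or.inr (by rw [← mem_range, range_psi]; exact ⟨h, h'⟩))
  refine ⟨Function.extend psi g fun _ => valMap, ?_, ?_, hval, hB, hT⟩
  · rw [continuous_iff_continuousAt]
    intro s
    rcases hcases s with rfl | rfl | ⟨x, rfl⟩
    · rw [ContinuousAt, hB, tendsto_iff_eventually]
      intro p hp
      obtain ⟨R, hR⟩ := eventually_atBot.1 (hbot.eventually hp)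
      have hlt : jBot < psi R := (range_psi ▸ mem_range_self R : psi R ∈ jInterior).1
      filter_upwards [Iio_mem_nhds hlt] with s hs
      rcases hcases s with rfl | rfl | ⟨x, rfl⟩
      · rw [hB]; exact hp.self_of_nhds
      · rw [hT]; exact hp.self_of_nhds
      · rw [hval]; exact hR x (strictMono_psi.lt_iff_lt.1 hs).le
    · rw [ContinuousAt, hT, tendsto_iff_eventually]
      intro p hp
      obtain ⟨R, hR⟩ := eventually_atTop.1 (htop.eventually hp)
      have hlt : psi R < jTop := (range_psi ▸ mem_range_self R : psi R ∈ jInterior).2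
      filter_upwards [Ioi_mem_nhds hlt] with s hs
      rcases hcases s with rfl | rfl | ⟨x, rfl⟩
      · rw [hB]; exact hp.self_of_nhds
      · rw [hT]; exact hp.self_of_nhds
      · rw [hval]; exact hR x (strictMono_psi.lt_iff_lt.1 hs).le
    · rw [← isOpenEmbedding_psi.continuousAt_iff]
      have : Function.extend psi g (fun _ => valMap) ∘ psi = g := funext hval
      rw [this]
      exact g.continuous.continuousAt
  · intro s
    rcases hcases s with rfl | rfl | ⟨x, rfl⟩
    · rw [hB]; exact valMap_mem
    · rw [hT]; exact valMap_mem
    · rw [hval]; exact hg x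

/-! ### Limit sets -/

/-- Limit sets depend only on tails, so it is enough to know the orbit explicitly from time `i` on.
-/
theorem omegaLimitSet_eq_of_orbit {X : Type*} [TopologicalSpace X] (f : X ≃ₜ X) (x : X) (i : ℕ)
    (z : ℕ → X) (h0 : f^[i] x = z 0) (hz : ∀ j, f (z j) = z (j + 1)) :
    omegaLimitSet f x = {y | ∃ φ : ℕ → ℕ, StrictMono φ ∧ Tendsto (z ∘ φ) atTop (𝓝 y)} := by
  have hit : ∀ j, f^[j + i] x = z j := by
    intro j
    induction j with
    | zero => simpa using h0
    | succ j ih => rw [Nat.add_right_comm, Function.iterate_succ_apply', ih, hz]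
  ext y
  constructor
  · rintro ⟨n, -, hn, hy⟩
    have hle : ∀ j, i ≤ n (j + i) := fun j => (Nat.le_add_left i j).trans (hn.id_le _)
    refine ⟨fun j => n (j + i) - i, fun a b hab => ?_, ?_⟩
    · have h1 := hn (Nat.add_lt_add_right hab i)
      have h2 := hle a
      simp only
      omega
    · refine (hy.comp (tendsto_add_atTop_nat i)).congr fun j => ?_
      simp only [Function.comp_apply]
      rw [← hit, Nat.sub_add_cancel (hle j)]
  · rintro ⟨φ, hφ, hy⟩
    -- The shift to `j + 1` keeps the times positive even when `φ 0 = 0` and `i = 0`.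
    refine ⟨fun j => φ (j + 1) + i, fun j => ?_, fun a b hab => ?_, ?_⟩
    · have := hφ (Nat.succ_pos j)
      simp only [Nat.succ_eq_add_one] at this ⊢
      omega
    · have := hφ (Nat.add_lt_add_right hab 1)
      simp only
      omega
    · refine (hy.comp (tendsto_add_atTop_nat 1)).congr fun j => ?_
      simp only [Function.comp_apply]
      rw [hit]

theorem exists_eq_of_mem_rowContinua {s : J} {A : Set (J × J)} (hA : A ∈ rowContinua s) :
    ∃ a b : ℝ, -1 ≤ a ∧ a ≤ b ∧ b ≤ 1 ∧ A = {p | p.2 = s ∧ a ≤ p.1 ∧ (p.1 : ℝ) ≤ b} := by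
  obtain ⟨hc, hcl, hrow⟩ := hA
  have hf : Continuous fun p : J × J => (p.1 : ℝ) := by fun_prop
  have hB := eq_Icc_of_connected_compact (hc.image _ hf.continuousOn)
    (hcl.isCompact.image hf)
  set a := sInf ((fun p : J × J => (p.1 : ℝ)) '' A)
  set b := sSup ((fun p : J × J => (p.1 : ℝ)) '' A)
  have hab : a ≤ b := nonempty_Icc.1 (hB ▸ hc.nonempty.image _)
  have hsub : Icc a b ⊆ Icc (-1) 1 := by
    rw [← hB]
    rintro _ ⟨p, -, rfl⟩
    exact p.1.2
  refine ⟨a, b, (hsub (left_mem_Icc.2 hab)).1, hab, (hsub (right_mem_Icc.2 hab)).2, ?_⟩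
  ext ⟨r, t⟩
  constructor
  · intro hp
    have h1 : (r : ℝ) ∈ Icc a b := hB ▸ ⟨_, hp, rfl⟩
    exact ⟨hrow hp, h1.1, h1.2⟩
  · rintro ⟨h1, h2, h3⟩
    have h4 : (r : ℝ) ∈ (fun p : J × J => (p.1 : ℝ)) '' A := hB ▸ ⟨h2, h3⟩
    obtain ⟨⟨r', t'⟩, hp, hr⟩ := h4
    have hr' : r' = r := Subtype.ext hr
    have ht' : t' = s := hrow hp
    simp only at h1
    rw [h1, ← ht', ← hr']
    exact hp

/-! ### A slowly oscillating sequence -/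

/-- A sequence sweeping the interval `[a, b]` back and forth ever more slowly. -/
noncomputable def sweep (a b : ℝ) (j : ℕ) : ℝ :=
  a + (b - a) * ((1 + Real.sin (Real.log (j + 1))) / 2)

theorem sweep_mem {a b : ℝ} (hab : a ≤ b) (j : ℕ) : sweep a b j ∈ Icc a b := by
  have h1 := Real.neg_one_le_sin (Real.log (j + 1))
  have h2 := Real.sin_le_one (Real.log (j + 1))
  unfold sweep
  constructor <;> nlinarith

theorem abs_sin_sub_sin_le (x y : ℝ) : |Real.sin x - Real.sin y| ≤ |x - y| := by
  have h := Convex.norm_image_sub_le_of_norm_deriv_le (f := Real.sin) (C := 1) (x := y) (y := x)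
    (s := univ) (fun _ _ => Real.differentiableAt_sin)
    (fun z _ => by simpa using Real.abs_cos_le_one z) convex_univ trivial trivial
  simpa using h

theorem log_add_one_sub_log_le {x : ℝ} (hx : 0 < x) : Real.log (x + 1) - Real.log x ≤ 1 / x := by
  rw [← Real.log_div (by positivity) hx.ne']
  refine (Real.log_le_sub_one_of_pos (by positivity)).trans (le_of_eq ?_)
  field_simp
  ring

theorem abs_sweep_succ_sub_le {a b : ℝ} (ha : -1 ≤ a) (hab : a ≤ b) (hb : b ≤ 1) (j : ℕ) :
    |sweep a b (j + 1) - sweep a b j| ≤ 1 / (j + 1) := by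
  have hpos : (0 : ℝ) < j + 1 := by positivity
  have h1 := abs_sin_sub_sin_le (Real.log (j + 1 + 1)) (Real.log (j + 1))
  have h2 := log_add_one_sub_log_le hpos
  have h3 : Real.log (j + 1) ≤ Real.log (j + 1 + 1) := Real.log_le_log hpos (by linarith)
  rw [abs_of_nonneg (sub_nonneg.2 h3)] at h1
  have h4 : sweep a b (j + 1) - sweep a b j =
      (b - a) / 2 * (Real.sin (Real.log (j + 1 + 1)) - Real.sin (Real.log (j + 1))) := by
    unfold sweep; push_cast; ring
  rw [h4, abs_mul, abs_of_nonneg (by linarith)]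
  calc (b - a) / 2 * _ ≤ 1 * (1 / ((j : ℝ) + 1)) :=
        mul_le_mul (by linarith) (h1.trans h2) (abs_nonneg _) zero_le_one
    _ = _ := one_mul _

/-- With `w` the sine value that yields `v`, take times `⌊exp x⌋` for `x = arcsin w + 2πi`: then
`log (⌊exp x⌋ + 1)` exceeds `x` by at most `exp (-x)`, which tends to `0`. -/
theorem exists_tendsto_sweep {a b : ℝ} {v : ℝ} (hv : v ∈ Icc a b) :
    ∃ φ : ℕ → ℕ, StrictMono φ ∧ Tendsto (sweep a b ∘ φ) atTop (𝓝 v) := by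
  obtain ⟨w, hw1, hw2, rfl⟩ : ∃ w : ℝ, -1 ≤ w ∧ w ≤ 1 ∧ v = a + (b - a) * ((1 + w) / 2) := by
    rcases (hv.1.trans hv.2).eq_or_lt with rfl | hab
    · exact ⟨0, by norm_num, by norm_num, by simpa using le_antisymm hv.2 hv.1⟩
    · have hab' : 0 < b - a := sub_pos.2 hab
      refine ⟨2 * ((v - a) / (b - a)) - 1, ?_, ?_, by field_simp; ring⟩
      · have := div_nonneg (sub_nonneg.2 hv.1) hab'.le
        linarith
      · have : (v - a) / (b - a) ≤ 1 := (div_le_one hab').2 (by linarith [hv.2])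
        linarith
  have hT : Tendsto (fun i : ℕ => Real.exp (Real.arcsin w + i * (2 * Real.pi))) atTop atTop :=
    Real.tendsto_exp_atTop.comp (tendsto_atTop_add_const_left _ _
      (tendsto_natCast_atTop_atTop.atTop_mul_const (by positivity)))
  have hn := tendsto_nat_floor_atTop.comp hT
  obtain ⟨σ, hσ, hφ⟩ := strictMono_subseq_of_tendsto_atTop hn
  refine ⟨_, hφ, ?_⟩
  suffices h : Tendsto (fun i : ℕ => Real.sin (Real.log
      ((⌊Real.exp (Real.arcsin w + i * (2 * Real.pi))⌋₊ : ℝ) + 1))) atTop (𝓝 w) by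
    have h' := (((h.const_add 1).div_const 2).const_mul (b - a)).const_add a
    exact h'.comp hσ.tendsto_atTop
  have hsin : ∀ i : ℕ, Real.sin (Real.arcsin w + i * (2 * Real.pi)) = w := fun i => by
    rw [Real.sin_add_nat_mul_two_pi, Real.sin_arcsin hw1 hw2]
  rw [tendsto_iff_dist_tendsto_zero]
  refine squeeze_zero (fun _ => dist_nonneg) (fun i => ?_) (tendsto_inv_atTop_zero.comp hT)
  set x := Real.arcsin w + i * (2 * Real.pi) with hx
  have he := Real.exp_pos x
  have hfl1 := Nat.floor_le he.le
  have hfl2 := Nat.lt_floor_add_one (Real.exp x)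
  have h1 : x ≤ Real.log ((⌊Real.exp x⌋₊ : ℝ) + 1) := by
    rw [Real.le_log_iff_exp_le (by positivity)]; exact hfl2.le
  have h2 : Real.log ((⌊Real.exp x⌋₊ : ℝ) + 1) ≤ Real.log (Real.exp x + 1) :=
    Real.log_le_log (by positivity) (by linarith)
  have h3 := log_add_one_sub_log_le he
  rw [Real.log_exp, one_div] at h3
  rw [Real.dist_eq]
  conv_lhs => rw [← hsin i, ← hx]
  refine (abs_sin_sub_sin_le _ _).trans ?_
  rw [abs_of_nonneg (by linarith)]
  simp only [Function.comp_apply, ← hx]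
  linarith

/-- The limit points of a sequence in the square which is asymptotic to a sweeping sequence in the
row `J_s`. -/
theorem limitPoints_eq {s : J} {a b : ℝ} (hab : a ≤ b)
    (z : ℕ → J × J) (M : ℕ) (h2 : Tendsto (fun j => (z j).2) atTop (𝓝 s))
    (h1 : Tendsto (fun j => ((z j).1 : ℝ) - sweep a b (M + j)) atTop (𝓝 0)) :
    {y | ∃ φ : ℕ → ℕ, StrictMono φ ∧ Tendsto (z ∘ φ) atTop (𝓝 y)} =
      {p : J × J | p.2 = s ∧ a ≤ p.1 ∧ (p.1 : ℝ) ≤ b} := by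
  ext ⟨r, t⟩
  constructor
  · rintro ⟨φ, hφ, hy⟩
    have ht : Tendsto (fun j => (z (φ j)).2) atTop (𝓝 t) := (continuous_snd.tendsto _).comp hy
    have hr : Tendsto (fun j => ((z (φ j)).1 : ℝ)) atTop (𝓝 r) :=
      ((continuous_subtype_val.comp continuous_fst).tendsto (r, t)).comp hy
    have hc : Tendsto (fun j => sweep a b (M + φ j)) atTop (𝓝 r) := by
      simpa using hr.sub (h1.comp hφ.tendsto_atTop)
    have hmem : (r : ℝ) ∈ Icc a b :=
      isClosed_Icc.mem_of_tendsto hc (Eventually.of_forall fun j => sweep_mem hab _)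
    exact ⟨tendsto_nhds_unique ht (h2.comp hφ.tendsto_atTop), hmem.1, hmem.2⟩
  · rintro ⟨hs, hr⟩
    simp only at hs hr
    subst hs
    obtain ⟨φ, hφ, hc⟩ := exists_tendsto_sweep (a := a) (b := b) (v := r) hr
    have hle : ∀ j, M ≤ φ (j + M) := fun j => (Nat.le_add_left M j).trans (hφ.id_le _)
    have hψ : StrictMono fun j => φ (j + M) - M := fun i j hij => by
      have h3 := hφ (Nat.add_lt_add_right hij M)
      have h4 := hle i
      simp only
      omega
    refine ⟨_, hψ, ?_⟩
    refine Tendsto.prodMk_nhds ?_ (h2.comp hψ.tendsto_atTop)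
    rw [tendsto_subtype_rng]
    have h3 := (h1.comp hψ.tendsto_atTop).add (hc.comp (tendsto_add_atTop_nat M))
    rw [zero_add] at h3
    refine h3.congr fun j => ?_
    simp only [Function.comp_apply]
    rw [Nat.add_sub_cancel' (hle j)]
    ring

/-! ### Homeomorphisms of `J` concentrating the interior at a point -/

/-- The differences `u ^ q - u ^ (q + 1)` decrease in `q` and telescope, so the last is at most the
average of the first `p + 1`. -/
theorem pow_sub_pow_succ_le {u : ℝ} (h0 : 0 ≤ u) (h1 : u ≤ 1) (p : ℕ) :
    u ^ p - u ^ (p + 1) ≤ 1 / (p + 1) := by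
  have key : (p + 1) * (u ^ p - u ^ (p + 1)) ≤ 1 - u ^ (p + 1) := by
    induction p with
    | zero => simp
    | succ p ih =>
      have h2 := mul_le_mul_of_nonneg_left ih h0
      have h3 : 0 ≤ (1 - u) * (1 - u ^ (p + 1)) :=
        mul_nonneg (by linarith) (sub_nonneg.2 (pow_le_one₀ h0 h1))
      push_cast
      simp only [pow_succ] at h2 h3 ⊢
      linarith
  rw [le_div_iff₀ (by positivity)]
  have := pow_nonneg h0 (p + 1)
  linarith

/-- For large `p` the function `squeeze c p` maps most of `J` close to `c`; for `p = 1` it is the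
identity. -/
noncomputable def squeeze (c : ℝ) (p : ℕ) (r : ℝ) : ℝ :=
  c + (1 - c) * ((1 + r) / 2) ^ p - (1 + c) * ((1 - r) / 2) ^ p

theorem monotoneOn_squeeze {c : ℝ} (hc : c ∈ Icc (-1 : ℝ) 1) (p : ℕ) :
    MonotoneOn (squeeze c p) (Icc (-1) 1) := by
  intro x hx y hy hxy
  have h1 : ((1 + x) / 2) ^ p ≤ ((1 + y) / 2) ^ p :=
    pow_le_pow_left₀ (by linarith [hx.1]) (by linarith) p
  have h2 : ((1 - y) / 2) ^ p ≤ ((1 - x) / 2) ^ p :=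
    pow_le_pow_left₀ (by linarith [hy.2]) (by linarith) p
  have h3 := mul_le_mul_of_nonneg_left h1 (by linarith [hc.2] : 0 ≤ 1 - c)
  have h4 := mul_le_mul_of_nonneg_left h2 (by linarith [hc.1] : 0 ≤ 1 + c)
  unfold squeeze
  linarith

theorem squeeze_neg_one (c : ℝ) (p : ℕ) : squeeze c (p + 1) (-1) = -1 := by
  norm_num [squeeze]

theorem squeeze_one (c : ℝ) (p : ℕ) : squeeze c (p + 1) 1 = 1 := by
  norm_num [squeeze]

theorem squeeze_mem {c : ℝ} (hc : c ∈ Icc (-1 : ℝ) 1) (p : ℕ) {r : ℝ} (hr : r ∈ Icc (-1 : ℝ) 1) :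
    squeeze c (p + 1) r ∈ Icc (-1 : ℝ) 1 := by
  constructor
  · rw [← squeeze_neg_one c p]
    exact monotoneOn_squeeze hc _ (by norm_num) hr hr.1
  · rw [← squeeze_one c p]
    exact monotoneOn_squeeze hc _ hr (by norm_num) hr.2

theorem abs_squeeze_sub_le {c c' : ℝ} (hc : c ∈ Icc (-1 : ℝ) 1) (p : ℕ) {r : ℝ}
    (hr : r ∈ Icc (-1 : ℝ) 1) :
    |squeeze c' (p + 2) r - squeeze c (p + 1) r| ≤ |c' - c| + 2 / (p + 2) := by
  have hu0 : 0 ≤ (1 + r) / 2 := by linarith [hr.1]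
  have hu1 : (1 + r) / 2 ≤ 1 := by linarith [hr.2]
  have hv0 : 0 ≤ (1 - r) / 2 := by linarith [hr.2]
  have hv1 : (1 - r) / 2 ≤ 1 := by linarith [hr.1]
  have hu := pow_sub_pow_succ_le hu0 hu1 (p + 1)
  have hv := pow_sub_pow_succ_le hv0 hv1 (p + 1)
  have hu' : ((1 + r) / 2) ^ (p + 1 + 1) ≤ ((1 + r) / 2) ^ (p + 1) :=
    pow_le_pow_of_le_one hu0 hu1 (Nat.le_succ _)
  have hv' : ((1 - r) / 2) ^ (p + 1 + 1) ≤ ((1 - r) / 2) ^ (p + 1) :=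
    pow_le_pow_of_le_one hv0 hv1 (Nat.le_succ _)
  have hle : ((1 + r) / 2) ^ (p + 1 + 1) + ((1 - r) / 2) ^ (p + 1 + 1) ≤ 1 := by
    have h1 : ((1 + r) / 2) ^ (p + 1 + 1) ≤ (1 + r) / 2 :=
      pow_le_of_le_one hu0 hu1 (by omega)
    have h2 : ((1 - r) / 2) ^ (p + 1 + 1) ≤ (1 - r) / 2 :=
      pow_le_of_le_one hv0 hv1 (by omega)
    linarith
  have hU := pow_nonneg hu0 (p + 1 + 1)
  have hV := pow_nonneg hv0 (p + 1 + 1)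
  have hq : ((p + 1 : ℕ) : ℝ) + 1 = p + 2 := by push_cast; ring
  rw [hq] at hu hv
  have hq2 : (2 : ℝ) / (p + 2) = 2 * (1 / (p + 2)) := by ring
  unfold squeeze
  rw [hq2]
  change |c' + (1 - c') * ((1 + r) / 2) ^ (p + 1 + 1) - (1 + c') * ((1 - r) / 2) ^ (p + 1 + 1) -
    (c + (1 - c) * ((1 + r) / 2) ^ (p + 1) - (1 + c) * ((1 - r) / 2) ^ (p + 1))| ≤ _
  generalize ((1 + r) / 2) ^ (p + 1 + 1) = U' at *
  generalize ((1 - r) / 2) ^ (p + 1 + 1) = V' at *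
  generalize ((1 + r) / 2) ^ (p + 1) = U at *
  generalize ((1 - r) / 2) ^ (p + 1) = V at *
  generalize 1 / ((p : ℝ) + 2) = δ at *
  -- Moving the centre costs a factor in `[0, 1]`; changing the exponent costs at most `δ` for each
  -- of two terms whose weights `1 ± c` sum to 2.
  have e : c' + (1 - c') * U' - (1 + c') * V' - (c + (1 - c) * U - (1 + c) * V) =
      (c' - c) * (1 - U' - V') + ((1 + c) * (V - V') - (1 - c) * (U - U')) := by ring
  rw [e]
  refine (abs_add_le _ _).trans (add_le_add ?_ ?_)
  · rw [abs_mul]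
    refine mul_le_of_le_one_right (abs_nonneg _) ?_
    rw [abs_le]; constructor <;> linarith
  · have a1 := mul_nonneg (by linarith [hc.1] : 0 ≤ 1 + c) (sub_nonneg.2 hv')
    have a2 := mul_nonneg (by linarith [hc.2] : 0 ≤ 1 - c) (sub_nonneg.2 hu')
    have a3 := mul_le_mul_of_nonneg_left hv (by linarith [hc.1] : 0 ≤ 1 + c)
    have a4 := mul_le_mul_of_nonneg_left hu (by linarith [hc.2] : 0 ≤ 1 - c)
    have hδ : 0 ≤ δ := by linarith
    have a5 := mul_le_mul_of_nonneg_right hc.1 hδ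
    have a6 := mul_le_mul_of_nonneg_right hc.2 hδ
    rw [abs_le]; constructor <;> linarith

/-- A convex combination of the identity and `squeeze c (j + 1)`, equal to the identity for
`j ≤ k` and close to `squeeze c (j + 1)` for large `j`. -/
noncomputable def push (c : ℝ) (k j : ℕ) (r : ℝ) : ℝ :=
  r + ((j - k : ℕ) : ℝ) / (j + 1) * (squeeze c (j + 1) r - r)

theorem continuous_push (c : ℝ) (k j : ℕ) : Continuous (push c k j) := by
  unfold push squeeze
  fun_prop

/-- The function `push` on `J`. -/
noncomputable def pushMap (c : ℝ) (k j : ℕ) : C(J, ℝ) :=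
  ⟨fun r => push c k j r, (continuous_push c k j).comp continuous_subtype_val⟩

@[simp] theorem pushMap_apply (c : ℝ) (k j : ℕ) (r : J) : pushMap c k j r = push c k j r := rfl

theorem weight_lt_one (k j : ℕ) : ((j - k : ℕ) : ℝ) / (j + 1) < 1 := by
  rw [div_lt_one (by positivity)]
  exact_mod_cast Nat.lt_succ_of_le (Nat.sub_le j k)

theorem weight_nonneg (k j : ℕ) : 0 ≤ ((j - k : ℕ) : ℝ) / (j + 1) := by positivity

/-- Strictness comes from the identity summand, whose weight stays positive. -/
theorem pushMap_mem {c : ℝ} (hc : c ∈ Icc (-1 : ℝ) 1) (k j : ℕ) :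
    pushMap c k j ∈ increasingHomeos := by
  refine ⟨fun x y hxy => ?_, ?_, ?_⟩
  · have h1 := monotoneOn_squeeze hc (j + 1) x.2 y.2 hxy.le
    have h2 := mul_le_mul_of_nonneg_left h1 (weight_nonneg k j)
    have h3 := mul_lt_mul_of_pos_left (Subtype.coe_lt_coe.2 hxy) (sub_pos.2 (weight_lt_one k j))
    simp only [pushMap_apply, push]
    linarith
  · simp [push, jBot, squeeze_neg_one]
  · simp [push, jTop, squeeze_one]

theorem pushMap_zero (c : ℝ) (k : ℕ) : pushMap c k 0 = valMap := by
  ext r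
  simp [push]

theorem abs_weight_sub_le (k j : ℕ) :
    |((j + 1 - k : ℕ) : ℝ) / ((j + 1 : ℕ) + 1) - ((j - k : ℕ) : ℝ) / (j + 1)| ≤ 1 / (j + 1) := by
  rcases le_or_gt k j with h | h
  · obtain ⟨i, rfl⟩ := Nat.exists_eq_add_of_le h
    rw [add_assoc, Nat.add_sub_cancel_left, Nat.add_sub_cancel_left]
    have e : ((i + 1 : ℕ) : ℝ) / ((k + (i + 1) : ℕ) + 1) - (i : ℝ) / ((k + i : ℕ) + 1) =
        (k + 1) / ((k + i + 2) * (k + i + 1)) := by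
      push_cast
      field_simp
      ring
    rw [e, abs_of_nonneg (by positivity), div_le_div_iff₀ (by positivity) (by positivity)]
    push_cast
    have : (0 : ℝ) ≤ (i + 1) * (k + i + 1) := by positivity
    nlinarith
  · rw [Nat.sub_eq_zero_of_le h.le, Nat.sub_eq_zero_of_le (Nat.succ_le_of_lt h)]
    simp
    positivity

/-- In units of `1/(j+1)`: 2 for the change of weight, 1 for the centre, 2 for the exponent.
Uniformity in `k` matters because `k` varies with the orbit. -/
theorem abs_push_sub_le {c c' : ℝ} (hc : c ∈ Icc (-1 : ℝ) 1) (hc' : c' ∈ Icc (-1 : ℝ) 1) {k j : ℕ}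
    (hcc : |c' - c| ≤ 1 / (j + 1)) {r : ℝ} (hr : r ∈ Icc (-1 : ℝ) 1) :
    |push c' k (j + 1) r - push c k j r| ≤ 5 / (j + 1) := by
  have h1 := abs_squeeze_sub_le (c' := c') hc j hr
  have h2 := abs_weight_sub_le k j
  have h3 := squeeze_mem hc' (j + 1) hr
  have h4 : |squeeze c' (j + 2) r - r| ≤ 2 := by
    rw [abs_le]; constructor <;> linarith [h3.1, h3.2, hr.1, hr.2]
  have h5 : (2 : ℝ) / (j + 2) ≤ 2 * (1 / (j + 1)) := by
    rw [mul_one_div]; gcongr; norm_num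
  have h6 := weight_nonneg k j
  have h7 := weight_lt_one k j
  have e : push c' k (j + 1) r - push c k j r =
      (((j + 1 - k : ℕ) : ℝ) / ((j + 1 : ℕ) + 1) - ((j - k : ℕ) : ℝ) / (j + 1)) *
        (squeeze c' (j + 2) r - r) +
      ((j - k : ℕ) : ℝ) / (j + 1) * (squeeze c' (j + 2) r - squeeze c (j + 1) r) := by
    unfold push; ring
  have h8 : (5 : ℝ) / (j + 1) = 5 * (1 / (j + 1)) := by ring
  rw [e, h8]
  refine (abs_add_le _ _).trans ?_
  rw [abs_mul, abs_mul, abs_of_nonneg h6]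
  have h9 := mul_le_mul h2 h4 (abs_nonneg _) (by positivity)
  have h10 := mul_le_mul h7.le h1 (abs_nonneg _) zero_le_one
  linarith

/-- The weight tends to 1 and the powers of `(1 ± r)/2 < 1` vanish. This makes the limit sets
independent of the interior point `r`. -/
theorem tendsto_push_sub {c : ℕ → ℝ} (hc : ∀ j, c j ∈ Icc (-1 : ℝ) 1) (k : ℕ) {r : ℝ}
    (hr : r ∈ Ioo (-1 : ℝ) 1) : Tendsto (fun j => push (c j) k j r - c j) atTop (𝓝 0) := by
  have ht : Tendsto (fun j : ℕ => 1 - ((j - k : ℕ) : ℝ) / (j + 1)) atTop (𝓝 0) := by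
    have h1 := (tendsto_one_div_add_atTop_nhds_zero_nat (𝕜 := ℝ)).const_mul ((k : ℝ) + 1)
    rw [mul_zero] at h1
    refine h1.congr' ?_
    filter_upwards [eventually_ge_atTop k] with j hj
    rw [Nat.cast_sub hj]
    field_simp
    ring
  have hu : Tendsto (fun j : ℕ => ((1 + r) / 2) ^ (j + 1)) atTop (𝓝 0) :=
    (tendsto_add_atTop_iff_nat 1).2
      (tendsto_pow_atTop_nhds_zero_of_lt_one (by linarith [hr.1]) (by linarith [hr.2]))
  have hv : Tendsto (fun j : ℕ => ((1 - r) / 2) ^ (j + 1)) atTop (𝓝 0) :=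
    (tendsto_add_atTop_iff_nat 1).2
      (tendsto_pow_atTop_nhds_zero_of_lt_one (by linarith [hr.2]) (by linarith [hr.1]))
  refine squeeze_zero_norm (a := fun j : ℕ => (1 - ((j - k : ℕ) : ℝ) / (j + 1)) * 2 +
    (2 * ((1 + r) / 2) ^ (j + 1) + 2 * ((1 - r) / 2) ^ (j + 1))) (fun j => ?_) ?_
  · have h1 := weight_nonneg k j
    have h2 := weight_lt_one k j
    have h3 : 0 ≤ ((1 + r) / 2) ^ (j + 1) := pow_nonneg (by linarith [hr.1]) _
    have h4 : 0 ≤ ((1 - r) / 2) ^ (j + 1) := pow_nonneg (by linarith [hr.2]) _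
    obtain ⟨h5, h6⟩ := hc j
    have e : push (c j) k j r - c j = (1 - ((j - k : ℕ) : ℝ) / (j + 1)) * (r - c j) +
        ((j - k : ℕ) : ℝ) / (j + 1) *
          ((1 - c j) * ((1 + r) / 2) ^ (j + 1) - (1 + c j) * ((1 - r) / 2) ^ (j + 1)) := by
      unfold push squeeze; ring
    rw [Real.norm_eq_abs, e]
    refine (abs_add_le _ _).trans (add_le_add ?_ ?_)
    · rw [abs_mul, abs_of_nonneg (sub_nonneg.2 h2.le)]
      refine mul_le_mul_of_nonneg_left ?_ (sub_nonneg.2 h2.le)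
      rw [abs_le]; constructor <;> linarith [hr.1, hr.2]
    · rw [abs_mul, abs_of_nonneg h1]
      refine (mul_le_of_le_one_left (abs_nonneg _) h2.le).trans ?_
      have a1 := mul_nonneg (by linarith : 0 ≤ 1 - c j) h3
      have a2 := mul_nonneg (by linarith : 0 ≤ 1 + c j) h4
      have a3 := mul_nonneg (by linarith : 0 ≤ 1 + c j) h3
      have a4 := mul_nonneg (by linarith : 0 ≤ 1 - c j) h4
      rw [abs_le]; constructor <;> linarith
  · simpa using (ht.mul_const 2).add ((hu.const_mul 2).add (hv.const_mul 2))

/-! ### Two-sided sequences of homeomorphisms of `J` -/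

/-- A two-sided sequence of homeomorphisms of `J`, concentrating near `w` in the future and near
`w'` in the past. -/
noncomputable def twoSided (w w' : ℕ → ℝ) (k : ℕ) : ℤ → C(J, ℝ)
  | Int.ofNat j => pushMap (w j) k j
  | Int.negSucc j => pushMap (w' (j + 1)) k (j + 1)

/-- The two halves meet at index `0`, where both are the identity whatever `w 0` and `w' 0` are. -/
theorem twoSided_neg_natCast (w w' : ℕ → ℝ) (k j : ℕ) :
    twoSided w w' k (-(j : ℤ)) = pushMap (w' j) k j := by
  rcases j with _ | j
  · rw [pushMap_zero]; exact pushMap_zero _ _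
  · rfl

/-- The sequences of points of `J` along which the interior can be concentrated. -/
def SlowSequence (w : ℕ → ℝ) : Prop :=
  ∀ j, w j ∈ Icc (-1 : ℝ) 1 ∧ |w (j + 1) - w j| ≤ 1 / (j + 1)

theorem slowSequence_sweep {a b : ℝ} (ha : -1 ≤ a) (hab : a ≤ b) (hb : b ≤ 1) :
    SlowSequence (sweep a b) := fun j =>
  ⟨⟨ha.trans (sweep_mem hab j).1, (sweep_mem hab j).2.trans hb⟩, abs_sweep_succ_sub_le ha hab hb j⟩

theorem twoSided_mem {w w' : ℕ → ℝ} (hw : SlowSequence w) (hw' : SlowSequence w') (k : ℕ) (m : ℤ) :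
    twoSided w w' k m ∈ increasingHomeos := by
  rcases m with j | j
  · exact pushMap_mem (hw j).1 k j
  · exact pushMap_mem (hw' (j + 1)).1 k (j + 1)

theorem abs_twoSided_sub_le {w w' : ℕ → ℝ} (hw : SlowSequence w) (hw' : SlowSequence w') (k : ℕ)
    (x : ℝ) (r : J) :
    |twoSided w w' k (⌊x⌋ + 1) r - twoSided w w' k ⌊x⌋ r| ≤ 10 / (1 + |x|) := by
  -- The constant doubles because `1 + |x| ≤ j + 2 ≤ 2 (j + 1)`.
  have key : ∀ j : ℕ, |x| ≤ j + 1 → (5 : ℝ) / (j + 1) ≤ 10 / (1 + |x|) := by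
    intro j hj
    rw [div_le_div_iff₀ (by positivity) (by positivity)]
    linarith [(Nat.cast_nonneg j : (0 : ℝ) ≤ j)]
  have h1 := Int.floor_le x
  have h2 := Int.lt_floor_add_one x
  rcases le_or_gt 0 ⌊x⌋ with h | h
  · obtain ⟨j, hj⟩ := Int.eq_ofNat_of_zero_le h
    rw [hj] at h1 h2 ⊢
    have hj' : |x| ≤ j + 1 := by
      push_cast at h1 h2
      rw [abs_le]; constructor <;> linarith [(Nat.cast_nonneg j : (0 : ℝ) ≤ j)]
    refine le_trans ?_ (key j hj')
    exact abs_push_sub_le (hw j).1 (hw (j + 1)).1 (hw j).2 r.2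
  · obtain ⟨j, hj⟩ : ∃ j : ℕ, ⌊x⌋ = -((j + 1 : ℕ) : ℤ) := ⟨(-⌊x⌋ - 1).toNat, by omega⟩
    have hj1 : -((j + 1 : ℕ) : ℤ) + 1 = -(j : ℤ) := by push_cast; ring
    rw [hj] at h1 h2 ⊢
    have hj' : |x| ≤ j + 1 := by
      push_cast at h1 h2
      rw [abs_le]; constructor <;> linarith [(Nat.cast_nonneg j : (0 : ℝ) ≤ j)]
    refine le_trans ?_ (key j hj')
    rw [hj1, twoSided_neg_natCast, twoSided_neg_natCast, abs_sub_comm]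
    exact abs_push_sub_le (hw' j).1 (hw' (j + 1)).1 (hw' j).2 r.2

/-- The homeomorphism of `J` leading from term `m` to term `m + 1` of a two-sided sequence. -/
noncomputable def stepMap {w w' : ℕ → ℝ} (hw : SlowSequence w) (hw' : SlowSequence w') (k : ℕ)
    (m : ℤ) : C(J, ℝ) :=
  let e := (toIso _ (twoSided_mem hw hw' k m)).symm.trans (toIso _ (twoSided_mem hw hw' k (m + 1)))
  ⟨fun r => (e r : ℝ), continuous_subtype_val.comp e.continuous⟩

theorem stepMap_mem {w w' : ℕ → ℝ} (hw : SlowSequence w) (hw' : SlowSequence w') (k : ℕ)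
    (m : ℤ) : stepMap hw hw' k m ∈ increasingHomeos := coe_iso_mem _

theorem stepMap_toIso {w w' : ℕ → ℝ} (hw : SlowSequence w) (hw' : SlowSequence w') (k : ℕ)
    (m : ℤ) (r : J) : stepMap hw hw' k m (toIso _ (twoSided_mem hw hw' k m) r) =
      toIso _ (twoSided_mem hw hw' k (m + 1)) r := by
  simp [stepMap]

/-- Every point is a value of term `⌊x⌋`, so the distance to the identity is that between
consecutive terms. -/
theorem dist_stepMap_le {w w' : ℕ → ℝ} (hw : SlowSequence w) (hw' : SlowSequence w') (k : ℕ)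
    (x : ℝ) : dist (stepMap hw hw' k ⌊x⌋) valMap ≤ 10 / (1 + |x|) := by
  rw [ContinuousMap.dist_le (by positivity)]
  intro r
  obtain ⟨r, rfl⟩ := (toIso _ (twoSided_mem hw hw' k ⌊x⌋)).surjective r
  rw [stepMap_toIso, valMap_apply, Real.dist_eq]
  exact abs_twoSided_sub_le hw hw' k x r

/-! ### The limit sets of orbits with prescribed steps -/

/-- Used to cross the unprescribed steps, where all that matters about the first coordinate is that
it stays interior. -/
theorem iterate_skewHomeo_psi (F : J → C(J, ℝ)) (hF : ∀ s, F s ∈ increasingHomeos)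
    (hc : Continuous F) {r : J} (hr : r ∈ jInterior) (x : ℝ) (i : ℕ) :
    ∃ r' ∈ jInterior, (skewHomeo F hF hc)^[i] (r, psi x) = (r', psi (x + i)) := by
  induction i with
  | zero => exact ⟨r, hr, by simp⟩
  | succ i ih =>
    obtain ⟨r', hr', h⟩ := ih
    refine ⟨toIso _ (hF (psi (x + i))) r', (toIso_mem_jInterior _ _ _).2 hr', ?_⟩
    rw [Function.iterate_succ_apply', h, skewHomeo_apply, ← psi_add_one]
    push_cast
    rw [add_assoc]

theorem iterate_skewHomeo_symm_psi (F : J → C(J, ℝ)) (hF : ∀ s, F s ∈ increasingHomeos)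
    (hc : Continuous F) {r : J} (hr : r ∈ jInterior) (x : ℝ) (i : ℕ) :
    ∃ r' ∈ jInterior, (skewHomeo F hF hc).symm^[i] (r, psi x) = (r', psi (x - i)) := by
  induction i with
  | zero => exact ⟨r, hr, by simp⟩
  | succ i ih =>
    obtain ⟨r', hr', h⟩ := ih
    refine ⟨(toIso _ (hF (psi (x - (i + 1 : ℕ))))).symm r', ?_, ?_⟩
    · rw [← toIso_mem_jInterior _ (hF (psi (x - (i + 1 : ℕ)))), OrderIso.apply_symm_apply]
      exact hr'
    · rw [Function.iterate_succ_apply', h, Homeomorph.symm_apply_eq, skewHomeo_apply,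
        ← psi_add_one, OrderIso.apply_symm_apply]
      push_cast
      ring_nf

/-- Once the orbit reaches index `M ≥ k` at an interior `r'`, it continues as `G (M + j) u` with `u
= (G M)⁻¹ r'` interior, hence follows the sweep. The past is symmetric, starting from index `-M`. -/
theorem limitSets_eq (F : J → C(J, ℝ)) (hF : ∀ s, F s ∈ increasingHomeos) (hc : Continuous F)
    {a b a' b' : ℝ} (ha : -1 ≤ a) (hab : a ≤ b) (hb : b ≤ 1)
    (ha' : -1 ≤ a') (hab' : a' ≤ b') (hb' : b' ≤ 1) (k : ℕ) (x : ℝ)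
    (hstep : ∀ m : ℤ, k ≤ m.natAbs → F (psi (Int.fract x + m)) =
      stepMap (slowSequence_sweep ha hab hb) (slowSequence_sweep ha' hab' hb') k m)
    {r : J} (hr : r ∈ jInterior) :
    omegaLimitSet (skewHomeo F hF hc) (r, psi x) =
        {p | p.2 = jTop ∧ a ≤ p.1 ∧ (p.1 : ℝ) ≤ b} ∧
      alphaLimitSet (skewHomeo F hF hc) (r, psi x) =
        {p | p.2 = jBot ∧ a' ≤ p.1 ∧ (p.1 : ℝ) ≤ b'} := by
  have hw := slowSequence_sweep ha hab hb
  have hw' := slowSequence_sweep ha' hab' hb'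
  set f := skewHomeo F hF hc with hf
  set d := Int.fract x with hd
  let G : ℤ → J ≃o J := fun m => toIso _ (twoSided_mem hw hw' k m)
  have hG : ∀ m : ℤ, k ≤ m.natAbs → ∀ r, f (G m r, psi (d + m)) = (G (m + 1) r, psi (d + m + 1)) := by
    intro m hm r
    rw [hf, skewHomeo_apply, psi_add_one]
    refine Prod.ext (Subtype.ext ?_) rfl
    simp only [coe_toIso]
    rw [hstep m hm]
    exact stepMap_toIso hw hw' k m r
  have hx : x = d + ⌊x⌋ := (Int.fract_add_floor x).symm
  have hint : ∀ {m : ℤ} {r : J}, r ∈ jInterior → (G m).symm r ∈ jInterior := fun {m r} h => by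
    rw [← toIso_mem_jInterior _ (twoSided_mem hw hw' k m)]
    simpa [G] using h
  constructor
  · obtain ⟨i, M, hM, hi⟩ : ∃ i M : ℕ, k ≤ M ∧ ⌊x⌋ + i = M :=
      ⟨k + ⌊x⌋.natAbs, (⌊x⌋ + k + ⌊x⌋.natAbs).toNat, by omega, by omega⟩
    have hxi : x + i = d + ((M : ℤ) : ℝ) := by
      rw [← hi]; push_cast; linarith
    obtain ⟨r', hr', h⟩ := iterate_skewHomeo_psi F hF hc hr x i
    rw [hxi] at h
    set u := (G M).symm r' with hu
    have huI : (u : ℝ) ∈ Ioo (-1 : ℝ) 1 := hint hr'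
    rw [omegaLimitSet_eq_of_orbit f _ i
      (fun j => (G ((M + j : ℕ) : ℤ) u, psi (d + ((M + j : ℕ) : ℤ)))) (by simpa [hu] using h)]
    · refine limitPoints_eq hab _ M ?_ ?_
      · refine tendsto_psi_atTop.comp (tendsto_atTop_add_const_left _ _ ?_)
        simp only [Int.cast_natCast]
        exact tendsto_natCast_atTop_atTop.comp (tendsto_atTop_mono (fun j => Nat.le_add_left j M) tendsto_id)
      · have := (tendsto_push_sub (fun j => (hw j).1) k huI).comp
          (tendsto_atTop_mono (fun j => Nat.le_add_left j M) tendsto_id)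
        exact this
    · intro j
      rw [hG _ (by omega)]
      push_cast
      simp only [add_assoc]
  · obtain ⟨i, M, hM, hi⟩ : ∃ i M : ℕ, k ≤ M ∧ ⌊x⌋ - i = -M :=
      ⟨k + ⌊x⌋.natAbs, (-⌊x⌋ + k + ⌊x⌋.natAbs).toNat, by omega, by omega⟩
    have hxi : x - i = d + ((-(M : ℤ) : ℤ) : ℝ) := by
      rw [← hi]; push_cast; linarith
    obtain ⟨r', hr', h⟩ := iterate_skewHomeo_symm_psi F hF hc hr x i
    rw [hxi] at h
    set u := (G (-M)).symm r' with hu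
    have huI : (u : ℝ) ∈ Ioo (-1 : ℝ) 1 := hint hr'
    rw [alphaLimitSet, omegaLimitSet_eq_of_orbit f.symm _ i
      (fun j => (G (-((M + j : ℕ) : ℤ)) u, psi (d + ((-((M + j : ℕ) : ℤ) : ℤ) : ℝ))))
      (by simpa [hu] using h)]
    · refine limitPoints_eq hab' _ M ?_ ?_
      · refine tendsto_psi_atBot.comp (tendsto_atBot_add_const_left _ _ ?_)
        simp only [Int.cast_natCast, Int.cast_neg]
        exact tendsto_neg_atTop_atBot.comp (tendsto_natCast_atTop_atTop.comp
          (tendsto_atTop_mono (fun j => Nat.le_add_left j M) tendsto_id))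
      · have := (tendsto_push_sub (fun j => (hw' j).1) k huI).comp
          (tendsto_atTop_mono (fun j => Nat.le_add_left j M) tendsto_id)
        refine this.congr fun j => ?_
        simp only [Function.comp_apply, G, coe_toIso, twoSided_neg_natCast]
        rfl
    · intro j
      rw [Homeomorph.symm_apply_eq, hG _ (by omega)]
      have h1 : -((M + (j + 1) : ℕ) : ℤ) + 1 = -((M + j : ℕ) : ℤ) := by push_cast; ring
      rw [h1, add_assoc, ← h1]
      push_cast
      rfl

/-! ### Pairwise disjoint dense cosets of `ℚ` -/

/-- The coset `n√2 + ℚ`. -/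
def sqrtCoset (n : ℕ) : Set ℝ := {x | ∃ q : ℚ, x = n * √2 + q}

theorem sqrtCoset_eq_range (n : ℕ) : sqrtCoset n = range fun q : ℚ => n * √2 + (q : ℝ) := by
  ext x; simp [sqrtCoset, eq_comm]

theorem countable_sqrtCoset (n : ℕ) : (sqrtCoset n).Countable := by
  rw [sqrtCoset_eq_range]; exact countable_range _

theorem dense_sqrtCoset (n : ℕ) : Dense (sqrtCoset n) := by
  rw [sqrtCoset_eq_range]
  exact (Homeomorph.addLeft ((n : ℝ) * √2)).surjective.denseRange.comp Rat.denseRange_cast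
    (Homeomorph.addLeft _).continuous

theorem eq_of_mem_sqrtCoset {m n : ℕ} {x : ℝ} (hm : x ∈ sqrtCoset m) (hn : x ∈ sqrtCoset n) :
    m = n := by
  obtain ⟨p, rfl⟩ := hm
  obtain ⟨q, hq⟩ := hn
  by_contra hne
  have hne' : ((m : ℤ) - n) ≠ 0 := sub_ne_zero.2 (by exact_mod_cast hne)
  refine (irrational_sqrt_two.intCast_mul hne').ne_rat (q - p) ?_
  push_cast
  linarith

theorem fract_add_intCast_mem_sqrtCoset {n : ℕ} {x : ℝ} (hx : x ∈ sqrtCoset n) (m : ℤ) :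
    Int.fract x + m ∈ sqrtCoset n := by
  obtain ⟨q, hq⟩ := hx
  refine ⟨q - ⌊x⌋ + m, ?_⟩
  rw [Int.fract]
  push_cast
  linarith

/-! ### Local finiteness of the set of prescribed parameters -/

/-- A bounded window allows finitely many floors, which bound `e (Int.fract z)`; injectivity of `e`
leaves finitely many fractional parts. -/
theorem eventually_eq_of_active {Q : Set ℝ} (hQ : ∀ x ∈ Q, Int.fract x ∈ Q) {e : ℝ → ℕ}
    (he : InjOn e Q) (x : ℝ) :
    ∀ᶠ y in 𝓝 x, y ∈ {z | z ∈ Q ∧ e (Int.fract z) ≤ ⌊z⌋.natAbs} → y = x := by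
  set A : Set ℝ := {z | z ∈ Q ∧ e (Int.fract z) ≤ ⌊z⌋.natAbs} with hA
  have hfin : (A ∩ Icc (x - 1) (x + 1)).Finite := by
    refine Finite.of_finite_image (f := fun z => (⌊z⌋, e (Int.fract z))) ?_ ?_
    · refine ((finite_Icc ⌊x - 1⌋ ⌊x + 1⌋).prod
        (finite_Iic (max ⌊x - 1⌋.natAbs ⌊x + 1⌋.natAbs))).subset ?_
      rintro _ ⟨z, ⟨⟨-, hz⟩, h1, h2⟩, rfl⟩
      have h3 := Int.floor_mono h1
      have h4 := Int.floor_mono h2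
      refine ⟨⟨h3, h4⟩, hz.trans ?_⟩
      omega
    · rintro y ⟨⟨hy, -⟩, -⟩ z ⟨⟨hz, -⟩, -⟩ h
      obtain ⟨h1, h2⟩ := Prod.ext_iff.1 h
      have h3 := he (hQ y hy) (hQ z hz) h2
      simp only at h1
      rw [← Int.floor_add_fract y, ← Int.floor_add_fract z, h1, h3]
  filter_upwards [(hfin.subset sdiff_subset).isClosed.isOpen_compl.mem_nhds
      (show x ∈ ((A ∩ Icc (x - 1) (x + 1)) \ {x})ᶜ from fun h => h.2 rfl),
    Icc_mem_nhds (show x - 1 < x by linarith) (show x < x + 1 by linarith)] with y hy hy' hyA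
  by_contra hne
  exact hy ⟨⟨hyA, hy'⟩, hne⟩

theorem tendsto_bound : Tendsto (fun t : ℝ => 11 / (1 + t)) atTop (𝓝 0) :=
  tendsto_const_nhds.div_atTop (tendsto_atTop_add_const_left _ _ tendsto_id)

end NormallyRising

/-! ### Assembling the homeomorphism -/

open NormallyRising in
theorem corollary3p3 (N : Set ℕ+) (hN : N.Nonempty)
    (ω : N → NormallyRising.rowContinua NormallyRising.jTop)
    (α : N → NormallyRising.rowContinua NormallyRising.jBot) :
    ∃ (S : N → Set NormallyRising.J)
      (f : (NormallyRising.J × NormallyRising.J) ≃ₜ (NormallyRising.J × NormallyRising.J)),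
      (∀ n, S n ⊆ NormallyRising.jInterior) ∧
      (∀ n, (S n).Countable) ∧
      (∀ m n, m ≠ n → Disjoint (S m) (S n)) ∧
      NormallyRising.IsNormallyRising f ∧
      ∀ n, Dense (S n) ∧
        ∀ r ∈ NormallyRising.jInterior, ∀ s ∈ S n,
          NormallyRising.omegaLimitSet f (r, s) = (ω n : Set (NormallyRising.J × NormallyRising.J)) ∧
          NormallyRising.alphaLimitSet f (r, s) = (α n : Set (NormallyRising.J × NormallyRising.J)) := by
  classical
  choose a b ha hab hb hω using fun n => exists_eq_of_mem_rowContinua (ω n).2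
  choose a' b' ha' hab' hb' hα using fun n => exists_eq_of_mem_rowContinua (α n).2
  let L : N → Set ℝ := fun n => sqrtCoset (n : ℕ+)
  have hL : ∀ {m n : N} {x : ℝ}, x ∈ L m → x ∈ L n → m = n := fun hm hn =>
    Subtype.ext (PNat.coe_injective (eq_of_mem_sqrtCoset hm hn))
  -- Off the cosets the label is an arbitrary element of `N`; it is never used there.
  obtain ⟨label, hlabel⟩ : ∃ label : ℝ → N, ∀ n, ∀ x ∈ L n, label x = n := by
    refine ⟨fun x => if h : ∃ n, x ∈ L n then h.choose else ⟨_, hN.some_mem⟩, fun n x hx => ?_⟩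
    have h : ∃ n, x ∈ L n := ⟨n, hx⟩
    simp only [h, dif_pos]
    exact hL h.choose_spec hx
  obtain ⟨e, he⟩ := countable_iff_exists_injOn.1
    (countable_iUnion fun n : N => countable_sqrtCoset (n : ℕ+))
  have hQ : ∀ x ∈ ⋃ n, L n, Int.fract x ∈ ⋃ n, L n := by
    intro x hx
    obtain ⟨n, hn⟩ := mem_iUnion.1 hx
    exact mem_iUnion.2 ⟨n, by simpa using fract_add_intCast_mem_sqrtCoset hn 0⟩
  let step : N → ℕ → ℤ → C(J, ℝ) := fun n =>
    stepMap (slowSequence_sweep (ha n) (hab n) (hb n)) (slowSequence_sweep (ha' n) (hab' n) (hb' n))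
  obtain ⟨g, hg⟩ := exists_continuous_extension _ (eventually_eq_of_active hQ he)
    -- 11 rather than 10, since the extension lemma needs a strict bound.
    (fun x => 11 / (1 + |x|))
    (continuous_const.div (by fun_prop) fun x => by positivity) (fun x => by positivity)
    (fun x => step (label x) (e (Int.fract x)) ⌊x⌋)
    (fun x _ => ⟨stepMap_mem _ _ _ _, (dist_stepMap_le _ _ _ x).trans_lt (by gcongr; norm_num)⟩)
  have hbound : ∀ l : Filter ℝ, Tendsto (fun x => |x|) l atTop → Tendsto g l (𝓝 valMap) :=
    fun l hl => tendsto_iff_dist_tendsto_zero.2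
      (squeeze_zero (fun _ => dist_nonneg) (fun x => (hg x).2.1.le) (tendsto_bound.comp hl))
  obtain ⟨F, hFc, hF, hFg, hFbot, hFtop⟩ := exists_family g (fun x => (hg x).1)
    (hbound _ tendsto_abs_atTop_atTop) (hbound _ tendsto_abs_atBot_atTop)
  refine ⟨fun n => psi '' L n, skewHomeo F hF hFc, fun n => ?_,
    fun n => (countable_sqrtCoset _).image _, fun m n hmn => ?_,
    isNormallyRising_skewHomeo F hF hFc hFbot hFtop, fun n => ⟨?_, ?_⟩⟩
  · rw [← range_psi]
    exact image_subset_range _ _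
  · exact (disjoint_image_iff strictMono_psi.injective).2
      (disjoint_left.2 fun x hm hn => hmn (hL hm hn))
  · exact denseRange_psi.dense_image isOpenEmbedding_psi.continuous (dense_sqrtCoset _)
  · rintro r hr _ ⟨x, hx, rfl⟩
    rw [hω, hα]
    -- The threshold `e (Int.fract x)` is constant along the orbit `x + ℤ`, so one two-sided
    -- sequence governs all its prescribed steps.
    refine limitSets_eq F hF hFc (ha n) (hab n) (hb n) (ha' n) (hab' n) (hb' n)
      (e (Int.fract x)) x (fun m hm => ?_) hr
    have hmem := fract_add_intCast_mem_sqrtCoset hx m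
    have hfr : Int.fract (Int.fract x + m) = Int.fract x := by
      rw [Int.fract_add_intCast, Int.fract_fract]
    have hfl : ⌊Int.fract x + m⌋ = m := by simp
    rw [hFg, (hg _).2.2 ⟨mem_iUnion.2 ⟨n, hmem⟩, by rwa [hfr, hfl]⟩, hlabel n _ hmem, hfr, hfl]
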